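/- Let $\mathcal H_1,\mathcal H_2$ be separable Hilbert spaces (over $\mathbb R$ or over $\mathbb C$), let $\mathcal H=\mathcal H_1\otimes\mathcal H_2$ be their Hilbert space tensor product, let $N_1,N_2$ be countable index sets (for instance the positive integers), and let $r\ge 1$. For $j\in\{1,2\}$ let $\{f_{j,1,n}\}_{n\in N_j},\dots,\{f_{j,r,n}\}_{n\in N_j}$ be $r$ sequences in $\mathcal H_j$ that are linearly independent (as elements of the vector space of all sequences in $\mathcal H_j$ indexed by $N_j$), and let $\mathcal F=\{f_{m,n}\}_{(m,n)\in N_1\times N_2}$ be the sequence in $\mathcal H$ given by $$f_{m,n}=\sum_{k=1}^{r} f_{1,k,m}\otimes f_{2,k,n}.$$ A sequence $\{g_n\}_{n \in N}$ in a Hilbert space $\mathcal K$ is a *Bessel sequence* if there is $B>0$ with $\sum_n|\langle g,g_n\rangle|^2\le B\|g\|^2$ for all $g\in\mathcal K$; it is a *frame* if there are $A,B>0$ with $A\|g\|^2\le\sum_n|\langle g,g_n\rangle|^2\le B\|g\|^2$ for all $g\in\mathcal K$; it is a *Riesz basis* if it is a frame and is the image of an orthonormal basis of $\mathcal K$, indexed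 by the same set $N$, under a continuous invertible linear map of $\mathcal K$ onto itself. 1. (i) $\mathcal F$ is a Bessel sequence in $\mathcal H$ if and only if $\{f_{j,k,n}\}_{n\in N_j}$ is a Bessel sequence in $\mathcal H_j$ for all $j\in\{1,2\}$ and $k\in\{1,\dots,r\}$. 2. (ii) Suppose that $\mathcal F$ is a frame in $\mathcal H$. Then, for all orthonormal bases $\{e_{j,n}\}_{n\in N_j}$ of $\mathcal H_j$ ($j=1,2$), the formula $F_{j,k}(f)=\sum_{n\in N_j}\langle f,f_{j,k,n}\rangle e_{j,n}$ defines bounded operators $F_{j,k}$ on $\mathcal H_j$, and there are bounded operators $L_{j,k}$ on $\mathcal H_j$ ($j=1,2$, $k=1,\dots,r$) such that $$\sum_{k=1}^r L_{j,k}F_{j,k}=I_j\qquad (j=1,2),$$ where $I_j$ is the identity of $\mathcal H_j$. In addition, for each $j\in\{1,2\}$ the concatenated sequence $\{f_{j,k,n}\}_{1\le k\le r,\ n\in N_j}$ is a frame in $\mathcal H_j$. 3. (iii) Suppose that $\mathcal F$ is a Riesz basis of $\mathcal H$. Then the conclusions of (ii) hold, and in addition, for all orthonormal bases and with $F_{j,k}$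 as in (ii), there are bounded operators $R_{j,k}$ on $\mathcal H_j$ such that $$\sum_{k=1}^r F_{j,k}R_{j,k}=I_j\qquad (j=1,2).$$ -/

import Mathlib

open scoped TensorProduct InnerProductSpace

section SequencesInHilbertSpaces

variable {𝕜 : Type*} [RCLike 𝕜] {E : Type*} [NormedAddCommGroup E] [InnerProductSpace 𝕜 E]
  {ι : Type*}

/-- `f` is a Bessel sequence: for some `B > 0`, the series `∑ i, |⟨x, f i⟩|²` converges for every `x`
and its sum is at most `B ‖x‖²`. (Mathlib's inner product is linear in the second variable, so
`⟪f i, x⟫` is the usual `⟨x, f i⟩`.) -/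
def IsBesselSeq (𝕜 : Type*) [RCLike 𝕜] {E : Type*} [NormedAddCommGroup E]
    [InnerProductSpace 𝕜 E] {ι : Type*} (f : ι → E) : Prop :=
  ∃ B : ℝ, 0 < B ∧ ∀ x : E, Summable (fun i => ‖⟪f i, x⟫_𝕜‖ ^ 2) ∧
    ∑' i, ‖⟪f i, x⟫_𝕜‖ ^ 2 ≤ B * ‖x‖ ^ 2

/-- `f` is a frame: for some `A, B > 0`, the series `∑ i, |⟨x, f i⟩|²` converges for every `x`
and its sum lies between `A ‖x‖²` and `B ‖x‖²`. -/
def IsFrameSeq (𝕜 : Type*) [RCLike 𝕜] {E : Type*} [NormedAddCommGroup E]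
    [InnerProductSpace 𝕜 E] {ι : Type*} (f : ι → E) : Prop :=
  ∃ A B : ℝ, 0 < A ∧ 0 < B ∧ ∀ x : E, Summable (fun i => ‖⟪f i, x⟫_𝕜‖ ^ 2) ∧
    A * ‖x‖ ^ 2 ≤ ∑' i, ‖⟪f i, x⟫_𝕜‖ ^ 2 ∧ ∑' i, ‖⟪f i, x⟫_𝕜‖ ^ 2 ≤ B * ‖x‖ ^ 2

/-- `f` is a Riesz basis: a frame that is the image of an orthonormal basis under a continuous
invertible linear map of the space onto itself. -/
def IsRieszBasisSeq (𝕜 : Type*) [RCLike 𝕜] {E : Type*} [NormedAddCommGroup E]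
    [InnerProductSpace 𝕜 E] {ι : Type*} (f : ι → E) : Prop :=
  IsFrameSeq 𝕜 f ∧ ∃ (e : HilbertBasis ι 𝕜 E) (T : E ≃L[𝕜] E), ∀ i, f i = T (e i)

/-- The operator associated to the orthonormal basis `e` and the sequence `f`, that is
`x ↦ ∑ i, ⟨x, f i⟩ e i`, is defined on the whole space and is the bounded operator `F`.
At most one `F` has this property, since sums are unique. -/
def IsAssociatedOp (e : HilbertBasis ι 𝕜 E) (f : ι → E) (F : E →L[𝕜] E) : Prop :=
  ∀ x : E, HasSum (fun i => ⟪f i, x⟫_𝕜 • e i) (F x)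

end SequencesInHilbertSpaces

section HilbertTensorProduct

/-- The Hilbert space tensor product: the completion of the algebraic tensor product for the inner
product with `⟨x ⊗ y, x' ⊗ y'⟩ = ⟨x, x'⟩ ⟨y, y'⟩`. -/
abbrev HilbertTensor (𝕜 : Type*) [RCLike 𝕜] (E F : Type*)
    [NormedAddCommGroup E] [InnerProductSpace 𝕜 E]
    [NormedAddCommGroup F] [InnerProductSpace 𝕜 F] : Type _ :=
  UniformSpace.Completion (E ⊗[𝕜] F)

/-- The elementary tensor `x ⊗ y` in the Hilbert space tensor product. -/
noncomputable def hilbertTmul (𝕜 : Type*) [RCLike 𝕜] {E F : Type*}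
    [NormedAddCommGroup E] [InnerProductSpace 𝕜 E]
    [NormedAddCommGroup F] [InnerProductSpace 𝕜 F] (x : E) (y : F) : HilbertTensor 𝕜 E F :=
  ((x ⊗ₜ[𝕜] y : E ⊗[𝕜] F) : UniformSpace.Completion (E ⊗[𝕜] F))

/-- The sum of `r` tensor products of sequences,
`(m, n) ↦ f₁ 1 m ⊗ f₂ 1 n + ⋯ + f₁ r m ⊗ f₂ r n`. -/
noncomputable def sumTensorSeq (𝕜 : Type*) [RCLike 𝕜] {E F : Type*}
    [NormedAddCommGroup E] [InnerProductSpace 𝕜 E]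
    [NormedAddCommGroup F] [InnerProductSpace 𝕜 F] {ι₁ ι₂ : Type*} {r : ℕ}
    (f₁ : Fin r → ι₁ → E) (f₂ : Fin r → ι₂ → F) : ι₁ × ι₂ → HilbertTensor 𝕜 E F :=
  fun p => ∑ k, hilbertTmul 𝕜 (f₁ k p.1) (f₂ k p.2)

/-- The concatenated family `{f k n}`, indexed by all pairs `(k, n)`. -/
def concatSeq {E ι : Type*} {r : ℕ} (f : Fin r → ι → E) : Fin r × ι → E :=
  fun p => f p.1 p.2

end HilbertTensorProduct

/-! Against an elementary tensor `x ⊗ y`, the inner product of `f_{m,n}` is a sum over `k` of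
products of inner products in the two factors. Freezing `y` and `n` shows that the sequence `∑ k, c
k • f₁ k` is Bessel for `c k = ⟪y, f₂ k n⟫`. Independence of the `f₂ k` makes such vectors `c` span
`𝕜 ^ r`, so each `f₁ k` is Bessel (`span_inner_eq_top`, `IsInnerMul.isBesselSeq_left`). Conversely,
Bessel bounds multiply under tensoring (`IsInnerMul.frameEnergy_tmul_le`).

For a frame, freezing a nonzero `y` and applying Cauchy–Schwarz in `k` turns the lower bound at `x ⊗
y` into one for the concatenated sequence. Then `S = ∑ k, (F k)* F k` is coercive, and `L k = S⁻¹ (F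
k)*`.

For a Riesz basis, applying `T⁻¹` to a slice with `n` fixed gives an orthonormal sequence of the
form `∑ k, J k ((F k)* (e m))`. Hence `∑ k, J k (F k)*` is bounded below, so the `(F k)*` are
jointly bounded below; taking adjoints of their left inverses gives the `R k`. -/

open scoped ENNReal NNReal

/-! ### Frame sums in `ℝ≥0∞` and the space of Bessel sequences -/

section Energy

variable {𝕜 : Type*} [RCLike 𝕜] {E : Type*} [NormedAddCommGroup E] [InnerProductSpace 𝕜 E]
  {ι κ : Type*}

/-- The sum `∑ i, |⟨x, f i⟩|²` as an extended nonnegative real. -/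
noncomputable def frameEnergy (𝕜 : Type*) [RCLike 𝕜] {E : Type*} [NormedAddCommGroup E]
    [InnerProductSpace 𝕜 E] {ι : Type*} (f : ι → E) (x : E) : ℝ≥0∞ :=
  ∑' i, ‖⟪f i, x⟫_𝕜‖ₑ ^ 2

theorem enorm_sq_eq_ofReal {G : Type*} [SeminormedAddCommGroup G] (z : G) :
    ‖z‖ₑ ^ 2 = ENNReal.ofReal (‖z‖ ^ 2) := by
  rw [ENNReal.ofReal_pow (norm_nonneg _), ofReal_norm]

theorem frameEnergy_eq_ofReal {f : ι → E} {x : E} (h : Summable fun i => ‖⟪f i, x⟫_𝕜‖ ^ 2) :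
    frameEnergy 𝕜 f x = ENNReal.ofReal (∑' i, ‖⟪f i, x⟫_𝕜‖ ^ 2) := by
  simp_rw [frameEnergy, enorm_sq_eq_ofReal]
  exact (ENNReal.ofReal_tsum_of_nonneg (fun _ => by positivity) h).symm

theorem summable_of_frameEnergy_ne_top {f : ι → E} {x : E} (h : frameEnergy 𝕜 f x ≠ ∞) :
    Summable fun i => ‖⟪f i, x⟫_𝕜‖ ^ 2 := by
  have := ENNReal.summable_toReal h
  simpa using this

/-- Finiteness in `ℝ≥0∞` encodes summability, so later sums can be split and interchanged without
convergence arguments. -/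
theorem frameEnergy_bound_iff {f : ι → E} {C : ℝ} (hC : 0 ≤ C) (x : E) :
    (Summable (fun i => ‖⟪f i, x⟫_𝕜‖ ^ 2) ∧ ∑' i, ‖⟪f i, x⟫_𝕜‖ ^ 2 ≤ C * ‖x‖ ^ 2) ↔
      frameEnergy 𝕜 f x ≤ ENNReal.ofReal C * ‖x‖ₑ ^ 2 := by
  rw [enorm_sq_eq_ofReal, ← ENNReal.ofReal_mul hC]
  constructor
  · rintro ⟨hs, hb⟩
    rw [frameEnergy_eq_ofReal hs]
    exact ENNReal.ofReal_le_ofReal hb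
  · intro h
    have hs := summable_of_frameEnergy_ne_top (ne_top_of_le_ne_top ENNReal.ofReal_ne_top h)
    refine ⟨hs, ?_⟩
    rw [frameEnergy_eq_ofReal hs] at h
    exact (ENNReal.ofReal_le_ofReal_iff (by positivity)).1 h

theorem isBesselSeq_iff_frameEnergy {f : ι → E} :
    IsBesselSeq 𝕜 f ↔ ∃ C : ℝ≥0, ∀ x, frameEnergy 𝕜 f x ≤ C * ‖x‖ₑ ^ 2 := by
  constructor
  · rintro ⟨C, hC, h⟩
    exact ⟨C.toNNReal, fun x => (frameEnergy_bound_iff hC.le x).1 (h x)⟩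
  · rintro ⟨C, h⟩
    -- `C` may be zero, while a Bessel constant must be positive.
    refine ⟨C + 1, by positivity, fun x => (frameEnergy_bound_iff (by positivity) x).2 ?_⟩
    refine (h x).trans ?_
    gcongr
    rw [← ENNReal.ofReal_coe_nnreal]
    exact ENNReal.ofReal_le_ofReal (by simp)

theorem isFrameSeq_iff_frameEnergy {f : ι → E} :
    IsFrameSeq 𝕜 f ↔ IsBesselSeq 𝕜 f ∧
      ∃ A : ℝ≥0, 0 < A ∧ ∀ x, A * ‖x‖ₑ ^ 2 ≤ frameEnergy 𝕜 f x := by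
  constructor
  · rintro ⟨A, C, hA, hC, h⟩
    refine ⟨⟨C, hC, fun x => ⟨(h x).1, (h x).2.2⟩⟩, A.toNNReal, by simpa, fun x => ?_⟩
    rw [frameEnergy_eq_ofReal (h x).1, enorm_sq_eq_ofReal]
    change ENNReal.ofReal A * _ ≤ _
    rw [← ENNReal.ofReal_mul hA.le]
    exact ENNReal.ofReal_le_ofReal (h x).2.1
  · rintro ⟨⟨C, hC, h⟩, A, hA, hl⟩
    refine ⟨A, C, hA, hC, fun x => ⟨(h x).1, ?_, (h x).2⟩⟩
    have := hl x
    rw [frameEnergy_eq_ofReal (h x).1, enorm_sq_eq_ofReal, ← ENNReal.ofReal_coe_nnreal,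
      ← ENNReal.ofReal_mul A.coe_nonneg] at this
    exact (ENNReal.ofReal_le_ofReal_iff (tsum_nonneg fun _ => by positivity)).1 this

theorem Orthonormal.frameEnergy_le {e : ι → E} (he : Orthonormal 𝕜 e) (x : E) :
    frameEnergy 𝕜 e x ≤ ‖x‖ₑ ^ 2 := by
  rw [frameEnergy_eq_ofReal (he.inner_products_summable x), enorm_sq_eq_ofReal]
  exact ENNReal.ofReal_le_ofReal (he.tsum_inner_products_le x)

theorem HilbertBasis.frameEnergy_eq (e : HilbertBasis ι 𝕜 E) (x : E) :
    frameEnergy 𝕜 e x = ‖x‖ₑ ^ 2 := by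
  rw [frameEnergy_eq_ofReal (e.orthonormal.inner_products_summable x), enorm_sq_eq_ofReal]
  congr 1
  have h := e.tsum_inner_mul_inner x x
  have hsq (i : ι) : ⟪x, e i⟫_𝕜 * ⟪e i, x⟫_𝕜 = ((‖⟪e i, x⟫_𝕜‖ ^ 2 : ℝ) : 𝕜) := by
    rw [← inner_conj_symm, RCLike.conj_mul]
    push_cast
    rfl
  simp_rw [hsq, inner_self_eq_norm_sq_to_K] at h
  exact_mod_cast h

theorem frameEnergy_comp_equiv (σ : κ ≃ ι) (f : ι → E) (x : E) :
    frameEnergy 𝕜 (f ∘ σ) x = frameEnergy 𝕜 f x :=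
  σ.tsum_eq fun i => ‖⟪f i, x⟫_𝕜‖ₑ ^ 2

theorem frameEnergy_concatSeq {r : ℕ} (f : Fin r → ι → E) (x : E) :
    frameEnergy 𝕜 (concatSeq f) x = ∑ k, frameEnergy 𝕜 (f k) x := by
  rw [frameEnergy, ENNReal.tsum_prod', tsum_fintype]
  rfl

theorem IsBesselSeq.comp_equiv {f : ι → E} (hf : IsBesselSeq 𝕜 f) (σ : κ ≃ ι) :
    IsBesselSeq 𝕜 (f ∘ σ) := by
  simp only [isBesselSeq_iff_frameEnergy, frameEnergy_comp_equiv] at *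
  exact hf

theorem IsFrameSeq.comp_equiv {f : ι → E} (hf : IsFrameSeq 𝕜 f) (σ : κ ≃ ι) :
    IsFrameSeq 𝕜 (f ∘ σ) := by
  simp only [isFrameSeq_iff_frameEnergy, isBesselSeq_iff_frameEnergy, frameEnergy_comp_equiv] at *
  exact hf

theorem enorm_sum_sq_le {G : Type*} [SeminormedAddCommGroup G] (s : Finset κ) (a : κ → G) :
    ‖∑ k ∈ s, a k‖ₑ ^ 2 ≤ s.card * ∑ k ∈ s, ‖a k‖ₑ ^ 2 := by
  have h : ‖∑ k ∈ s, a k‖₊ ^ 2 ≤ s.card * ∑ k ∈ s, ‖a k‖₊ ^ 2 :=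
    (pow_le_pow_left' (nnnorm_sum_le s a) 2).trans (sq_sum_le_card_mul_sum_sq)
  simp_rw [enorm_eq_nnnorm]
  exact_mod_cast h

theorem frameEnergy_add_le (f g : ι → E) (x : E) :
    frameEnergy 𝕜 (f + g) x ≤ 2 * (frameEnergy 𝕜 f x + frameEnergy 𝕜 g x) := by
  simp_rw [frameEnergy]
  rw [← ENNReal.tsum_add, ← ENNReal.tsum_mul_left]
  refine ENNReal.tsum_le_tsum fun i => ?_
  have := enorm_sum_sq_le Finset.univ ![⟪f i, x⟫_𝕜, ⟪g i, x⟫_𝕜]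
  simpa [Fin.sum_univ_two, inner_add_left] using this

theorem frameEnergy_smul (c : 𝕜) (f : ι → E) (x : E) :
    frameEnergy 𝕜 (c • f) x = ‖c‖ₑ ^ 2 * frameEnergy 𝕜 f x := by
  simp_rw [frameEnergy]
  rw [← ENNReal.tsum_mul_left]
  simp [inner_smul_left, enorm_mul, mul_pow]

/-- The Bessel sequences indexed by `ι` form a linear subspace. -/
def besselSubmodule (𝕜 : Type*) [RCLike 𝕜] (E : Type*) [NormedAddCommGroup E]
    [InnerProductSpace 𝕜 E] (ι : Type*) : Submodule 𝕜 (ι → E) where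
  carrier := {f | IsBesselSeq 𝕜 f}
  zero_mem' := isBesselSeq_iff_frameEnergy.2 ⟨0, fun x => by simp [frameEnergy]⟩
  add_mem' := by
    intro f g hf hg
    obtain ⟨C, hC⟩ := isBesselSeq_iff_frameEnergy.1 hf
    obtain ⟨D, hD⟩ := isBesselSeq_iff_frameEnergy.1 hg
    refine isBesselSeq_iff_frameEnergy.2 ⟨2 * (C + D), fun x => ?_⟩
    refine (frameEnergy_add_le f g x).trans ?_
    push_cast
    rw [mul_assoc, add_mul]
    gcongr
    exacts [hC x, hD x]
  smul_mem' := by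
    intro c f hf
    obtain ⟨C, hC⟩ := isBesselSeq_iff_frameEnergy.1 hf
    refine isBesselSeq_iff_frameEnergy.2 ⟨‖c‖₊ ^ 2 * C, fun x => ?_⟩
    rw [frameEnergy_smul, enorm_eq_nnnorm]
    push_cast
    rw [mul_assoc]
    gcongr
    exact hC x

theorem mem_besselSubmodule {f : ι → E} : f ∈ besselSubmodule 𝕜 E ι ↔ IsBesselSeq 𝕜 f := Iff.rfl

end Energy

/-! ### Associated operators and one-sided inverses -/

section BoundedOperators

variable {𝕜 : Type*} [RCLike 𝕜] {E : Type*} [NormedAddCommGroup E] [InnerProductSpace 𝕜 E]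
  {ι κ : Type*}

/-- The Bessel bound says exactly that the coefficients lie in `ℓ²`, with norm at most `√C ‖x‖`; the
basis `e` carries them isometrically back to `E`. -/
theorem IsBesselSeq.exists_isAssociatedOp {f : ι → E} (hf : IsBesselSeq 𝕜 f)
    (e : HilbertBasis ι 𝕜 E) : ∃ F : E →L[𝕜] E, IsAssociatedOp e f F := by
  obtain ⟨C, hC, h⟩ := hf
  have hmem (x : E) : Memℓp (fun i => ⟪f i, x⟫_𝕜) 2 :=
    memℓp_gen (by simpa using (h x).1)
  let A : E →ₗ[𝕜] E :=
    { toFun x := e.repr.symm ⟨fun i => ⟪f i, x⟫_𝕜, hmem x⟩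
      map_add' x y := by
        rw [← map_add]
        congr 1
        ext i
        exact inner_add_right _ _ _
      map_smul' c x := by
        rw [RingHom.id_apply, ← map_smul]
        congr 1
        ext i
        exact inner_smul_right _ _ _ }
  refine ⟨A.mkContinuous (Real.sqrt C) fun x => ?_, fun x => e.hasSum_repr_symm _⟩
  rw [← Real.sqrt_sq (norm_nonneg x), ← Real.sqrt_mul hC.le]
  refine Real.le_sqrt_of_sq_le (le_of_eq_of_le ?_ (h x).2)
  change ‖e.repr.symm _‖ ^ 2 = _
  rw [LinearIsometryEquiv.norm_map]
  have := lp.norm_rpow_eq_tsum (p := 2) (by simp)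
    (⟨fun i => ⟪f i, x⟫_𝕜, hmem x⟩ : lp (fun _ : ι => 𝕜) 2)
  simpa using this

theorem IsAssociatedOp.inner_basis {e : HilbertBasis ι 𝕜 E} {f : ι → E} {F : E →L[𝕜] E}
    (h : IsAssociatedOp e f F) (i : ι) (x : E) : ⟪e i, F x⟫_𝕜 = ⟪f i, x⟫_𝕜 := by
  classical
  have h1 := ((innerSL 𝕜 (e i)).hasSum (h x))
  have h2 : HasSum (fun j => ⟪e i, ⟪f j, x⟫_𝕜 • e j⟫_𝕜) ⟪f i, x⟫_𝕜 := by
    convert hasSum_ite_eq i ⟪f i, x⟫_𝕜 using 2 with j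
    rw [inner_smul_right, orthonormal_iff_ite.1 e.orthonormal]
    by_cases hij : j = i
    · simp [hij]
    · simp [hij, Ne.symm hij]
  exact h1.unique h2

theorem IsAssociatedOp.enorm_sq {e : HilbertBasis ι 𝕜 E} {f : ι → E} {F : E →L[𝕜] E}
    (h : IsAssociatedOp e f F) (x : E) : ‖F x‖ₑ ^ 2 = frameEnergy 𝕜 f x := by
  simp_rw [← e.frameEnergy_eq, frameEnergy, h.inner_basis]

variable [CompleteSpace E]

theorem IsAssociatedOp.adjoint_basis {e : HilbertBasis ι 𝕜 E} {f : ι → E} {F : E →L[𝕜] E}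
    (h : IsAssociatedOp e f F) (i : ι) : F.adjoint (e i) = f i :=
  ext_inner_right 𝕜 fun x => by rw [ContinuousLinearMap.adjoint_inner_left, h.inner_basis]

/-- A finite family of bounded operators that is jointly bounded below has a left inverse. -/
theorem exists_sum_comp_eq_id_of_le [Fintype κ] (F : κ → E →L[𝕜] E) {A : ℝ≥0} (hA : 0 < A)
    (h : ∀ x, A * ‖x‖ₑ ^ 2 ≤ ∑ k, ‖F k x‖ₑ ^ 2) :
    ∃ L : κ → E →L[𝕜] E, ∑ k, L k ∘L F k = ContinuousLinearMap.id 𝕜 E := by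
  set S : E →L[𝕜] E := ∑ k, (F k).adjoint ∘L F k with hS
  have hinner (x : E) : ⟪S x, x⟫_𝕜 = ((∑ k, ‖F k x‖ ^ 2 : ℝ) : 𝕜) := by
    simp [hS, sum_inner, ContinuousLinearMap.adjoint_inner_left,
      inner_self_eq_norm_sq_to_K]
  -- The hypothesis reads `A ‖x‖² ≤ ⟪S x, x⟫`, and a coercive operator is invertible.
  have hu : IsUnit S := by
    refine ContinuousLinearMap.isUnit_of_forall_le_norm_inner_map S hA fun x => ?_
    rw [hinner, RCLike.norm_ofReal, abs_of_nonneg (by positivity), mul_comm]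
    have := h x
    simp_rw [enorm_eq_nnnorm] at this
    have h' : A * ‖x‖₊ ^ 2 ≤ ∑ k, ‖F k x‖₊ ^ 2 := by exact_mod_cast this
    simpa only [NNReal.coe_mul, NNReal.coe_pow, NNReal.coe_sum, coe_nnnorm] using
      NNReal.coe_le_coe.2 h'
  obtain ⟨u, hu⟩ := hu
  refine ⟨fun k => (↑u⁻¹ : E →L[𝕜] E) ∘L (F k).adjoint, ?_⟩
  calc ∑ k, ((↑u⁻¹ : E →L[𝕜] E) ∘L (F k).adjoint) ∘L F k = (↑u⁻¹ : E →L[𝕜] E) * S := by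
        rw [hS, Finset.mul_sum]
        rfl
    _ = ContinuousLinearMap.id 𝕜 E := by
        rw [← hu, Units.inv_mul]
        rfl

theorem exists_sum_comp_eq_id_of_adjoint_le [Fintype κ] (F : κ → E →L[𝕜] E) {A : ℝ≥0}
    (hA : 0 < A) (h : ∀ x, A * ‖x‖ₑ ^ 2 ≤ ∑ k, ‖(F k).adjoint x‖ₑ ^ 2) :
    ∃ R : κ → E →L[𝕜] E, ∑ k, F k ∘L R k = ContinuousLinearMap.id 𝕜 E := by
  obtain ⟨L, hL⟩ := exists_sum_comp_eq_id_of_le (fun k => (F k).adjoint) hA h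
  refine ⟨fun k => (L k).adjoint, ?_⟩
  have := congrArg ContinuousLinearMap.adjoint hL
  rw [map_sum, ContinuousLinearMap.adjoint_id] at this
  simpa [ContinuousLinearMap.adjoint_comp] using this

/-- A frame obtained by concatenation has its associated operators jointly left invertible. -/
theorem IsFrameSeq.exists_sum_comp_eq_id {r : ℕ} {f : Fin r → ι → E}
    (hf : IsFrameSeq 𝕜 (concatSeq f)) {e : HilbertBasis ι 𝕜 E} {F : Fin r → E →L[𝕜] E}
    (hF : ∀ k, IsAssociatedOp e (f k) (F k)) :
    ∃ L : Fin r → E →L[𝕜] E, ∑ k, L k ∘L F k = ContinuousLinearMap.id 𝕜 E := by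
  obtain ⟨-, A, hA, h⟩ := isFrameSeq_iff_frameEnergy.1 hf
  refine exists_sum_comp_eq_id_of_le F hA fun x => ?_
  simp_rw [fun k => (hF k).enorm_sq x]
  rw [← frameEnergy_concatSeq]
  exact h x

end BoundedOperators

/-! ### Sums of products under a bilinear map that multiplies inner products -/

section TensorLike

variable {𝕜 : Type*} [RCLike 𝕜] {E F K : Type*} [NormedAddCommGroup E] [InnerProductSpace 𝕜 E]
  [NormedAddCommGroup F] [InnerProductSpace 𝕜 F] [NormedAddCommGroup K] [InnerProductSpace 𝕜 K]
  {ι₁ ι₂ : Type*} {r : ℕ}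

/-- A bounded bilinear map under which inner products multiply, as for the tensor product. -/
def IsInnerMul (B : E →L[𝕜] F →L[𝕜] K) : Prop :=
  ∀ x x' y y', ⟪B x y, B x' y'⟫_𝕜 = ⟪x, x'⟫_𝕜 * ⟪y, y'⟫_𝕜

/-- The sequence `(m, n) ↦ ∑ k, B (f₁ k m) (f₂ k n)`. -/
def bilinSumSeq (B : E →L[𝕜] F →L[𝕜] K) (f₁ : Fin r → ι₁ → E) (f₂ : Fin r → ι₂ → F) :
    ι₁ × ι₂ → K :=
  fun p => ∑ k, B (f₁ k p.1) (f₂ k p.2)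

theorem bilinSumSeq_flip (B : E →L[𝕜] F →L[𝕜] K) (f₁ : Fin r → ι₁ → E) (f₂ : Fin r → ι₂ → F) :
    bilinSumSeq B.flip f₂ f₁ = bilinSumSeq B f₁ f₂ ∘ Equiv.prodComm ι₂ ι₁ := rfl

theorem eq_zero_of_forall_sum_mul_inner {f : Fin r → ι₂ → F} (hf : LinearIndependent 𝕜 f)
    {a : Fin r → 𝕜} (h : ∀ y n, ∑ k, a k * ⟪y, f k n⟫_𝕜 = 0) : a = 0 := by
  funext k
  refine Fintype.linearIndependent_iff.1 hf a ?_ k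
  funext n
  refine ext_inner_left 𝕜 fun y => ?_
  simpa [Finset.sum_apply, inner_sum, inner_smul_right] using h y n

/-- If `f` is linearly independent then the vectors `(⟨y, f k n⟩)ₖ` span `𝕜 ^ r`. -/
theorem span_inner_eq_top {f : Fin r → ι₂ → F} (hf : LinearIndependent 𝕜 f) :
    Submodule.span 𝕜 (Set.range fun p : F × ι₂ => fun k => ⟪p.1, f k p.2⟫_𝕜) =
      (⊤ : Submodule 𝕜 (Fin r → 𝕜)) := by
  by_contra hne
  -- A nonzero functional vanishing on a proper subspace has coordinates that would be a linear
  -- relation among the `f k`.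
  obtain ⟨φ, hφ, hker⟩ := Submodule.exists_le_ker_of_lt_top _ (lt_top_iff_ne_top.2 hne)
  refine hφ ((Pi.basisFun 𝕜 (Fin r)).ext fun k => ?_)
  have hz : (fun k => φ (Pi.single k 1)) = 0 := by
    refine eq_zero_of_forall_sum_mul_inner hf fun y n => ?_
    have h0 : φ (fun k => ⟪y, f k n⟫_𝕜) = 0 :=
      hker (Submodule.subset_span ⟨(y, n), rfl⟩)
    have hs (j : Fin r) : (Pi.single j 1 : Fin r → 𝕜) = fun i => if j = i then 1 else 0 := by
      funext i
      simp [Pi.single_apply, eq_comm]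
    rw [LinearMap.pi_apply_eq_sum_univ] at h0
    simpa only [hs, smul_eq_mul, mul_comm] using h0
  simpa using congrFun hz k

variable {B : E →L[𝕜] F →L[𝕜] K}

theorem IsInnerMul.flip (hB : IsInnerMul B) : IsInnerMul B.flip := fun x x' y y' => by
  simpa [mul_comm] using hB y y' x x'

theorem IsInnerMul.enorm_apply (hB : IsInnerMul B) (x : E) (y : F) :
    ‖B x y‖ₑ = ‖x‖ₑ * ‖y‖ₑ := by
  have h : ‖B x y‖ = ‖x‖ * ‖y‖ := by
    have := hB x x y y
    simp_rw [inner_self_eq_norm_sq_to_K, ← mul_pow] at this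
    exact (pow_left_inj₀ (by positivity) (by positivity) two_ne_zero).1 (by exact_mod_cast this)
  simp_rw [← ofReal_norm, h, ENNReal.ofReal_mul (norm_nonneg _)]

theorem IsInnerMul.inner_bilinSumSeq (hB : IsInnerMul B) (f₁ : Fin r → ι₁ → E)
    (f₂ : Fin r → ι₂ → F) (m : ι₁) (n : ι₂) (x : E) (y : F) :
    ⟪bilinSumSeq B f₁ f₂ (m, n), B x y⟫_𝕜 = ∑ k, ⟪f₁ k m, x⟫_𝕜 * ⟪f₂ k n, y⟫_𝕜 := by
  simp [bilinSumSeq, sum_inner, hB _ _ _ _]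

/-- The first factors of a Bessel sequence of sums of tensors are Bessel sequences. -/
theorem IsInnerMul.isBesselSeq_left (hB : IsInnerMul B) {f₁ : Fin r → ι₁ → E}
    {f₂ : Fin r → ι₂ → F} (hf₂ : LinearIndependent 𝕜 f₂)
    (h : IsBesselSeq 𝕜 (bilinSumSeq B f₁ f₂)) (k : Fin r) : IsBesselSeq 𝕜 (f₁ k) := by
  classical
  obtain ⟨C, hC⟩ := isBesselSeq_iff_frameEnergy.1 h
  let T : (Fin r → 𝕜) →ₗ[𝕜] (ι₁ → E) := Fintype.linearCombination 𝕜 f₁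
  -- The coefficient vectors whose combination of the `f₁ k` is Bessel form a subspace; it contains
  -- a spanning set, given by the slices with `n` fixed.
  have hT : Submodule.comap T (besselSubmodule 𝕜 E ι₁) = ⊤ := by
    rw [eq_top_iff, ← span_inner_eq_top hf₂, Submodule.span_le]
    rintro _ ⟨⟨y, n⟩, rfl⟩
    refine isBesselSeq_iff_frameEnergy.2 ⟨C * ‖y‖₊ ^ 2, fun x => ?_⟩
    calc frameEnergy 𝕜 (T fun k => ⟪y, f₂ k n⟫_𝕜) x
        = ∑' m, ‖⟪bilinSumSeq B f₁ f₂ (m, n), B x y⟫_𝕜‖ₑ ^ 2 := by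
          refine tsum_congr fun m => ?_
          simp [T, Fintype.linearCombination_apply, hB.inner_bilinSumSeq, sum_inner,
            inner_smul_left, mul_comm]
      _ ≤ frameEnergy 𝕜 (bilinSumSeq B f₁ f₂) (B x y) :=
          ENNReal.tsum_comp_le_tsum_of_injective
            (f := fun m : ι₁ => (m, n)) (fun _ _ h => (Prod.ext_iff.1 h).1) _
      _ ≤ C * ‖B x y‖ₑ ^ 2 := hC _
      _ = _ := by
          rw [hB.enorm_apply, enorm_eq_nnnorm y]
          push_cast
          ring
  have : Pi.single k 1 ∈ Submodule.comap T (besselSubmodule 𝕜 E ι₁) := hT ▸ Submodule.mem_top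
  simpa [T, mem_besselSubmodule] using this

/-- The two Bessel bounds are used one variable at a time: adjoints of `B x` and `B.flip y` move `z`
into a single factor, and Parseval with an interchange of sums passes from one variable to the
other. -/
theorem IsInnerMul.frameEnergy_tmul_le [CompleteSpace E] [CompleteSpace F] [CompleteSpace K]
    (hB : IsInnerMul B) {f : ι₁ → E} {g : ι₂ → F} {C D : ℝ≥0}
    (hf : ∀ x, frameEnergy 𝕜 f x ≤ C * ‖x‖ₑ ^ 2) (hg : ∀ y, frameEnergy 𝕜 g y ≤ D * ‖y‖ₑ ^ 2)
    (z : K) : frameEnergy 𝕜 (fun p : ι₁ × ι₂ => B (f p.1) (g p.2)) z ≤ D * C * ‖z‖ₑ ^ 2 := by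
  obtain ⟨w₁, d, -⟩ := exists_hilbertBasis 𝕜 E
  obtain ⟨w₂, e, -⟩ := exists_hilbertBasis 𝕜 F
  have hR (x : E) (y : F) : ⟪B x y, z⟫_𝕜 = ⟪y, (B x).adjoint z⟫_𝕜 :=
    ((B x).adjoint_inner_right y z).symm
  have hL (x : E) (y : F) : ⟪B x y, z⟫_𝕜 = ⟪x, (B.flip y).adjoint z⟫_𝕜 :=
    ((B.flip y).adjoint_inner_right x z).symm
  -- Only Bessel's inequality is needed for this family, so its completeness in `K` plays no role.
  have hde : Orthonormal 𝕜 fun p : w₁ × w₂ => B (d p.1) (e p.2) := by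
    classical
    rw [orthonormal_iff_ite]
    rintro ⟨i, j⟩ ⟨i', j'⟩
    rw [hB, orthonormal_iff_ite.1 d.orthonormal, orthonormal_iff_ite.1 e.orthonormal]
    simp only [Prod.mk.injEq, ite_and, mul_ite, mul_one, mul_zero]
    split_ifs <;> rfl
  calc frameEnergy 𝕜 (fun p : ι₁ × ι₂ => B (f p.1) (g p.2)) z
      = ∑' m, frameEnergy 𝕜 g ((B (f m)).adjoint z) := by
        rw [frameEnergy, ENNReal.tsum_prod']
        simp_rw [hR, frameEnergy]
    _ ≤ ∑' m, D * ‖(B (f m)).adjoint z‖ₑ ^ 2 := ENNReal.tsum_le_tsum fun m => hg _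
    _ = D * ∑' m, ∑' j, ‖⟪f m, (B.flip (e j)).adjoint z⟫_𝕜‖ₑ ^ 2 := by
        simp_rw [ENNReal.tsum_mul_left, ← e.frameEnergy_eq, frameEnergy, ← hR, ← hL]
    _ = D * ∑' j, frameEnergy 𝕜 f ((B.flip (e j)).adjoint z) := by
        rw [ENNReal.tsum_comm]
        rfl
    _ ≤ D * ∑' j, C * ‖(B.flip (e j)).adjoint z‖ₑ ^ 2 := by
        gcongr with j
        exact hf _
    _ = D * C * frameEnergy 𝕜 (fun p : w₁ × w₂ => B (d p.1) (e p.2)) z := by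
        rw [ENNReal.tsum_mul_left, ← mul_assoc, frameEnergy, ENNReal.tsum_prod', ENNReal.tsum_comm]
        simp_rw [← d.frameEnergy_eq, frameEnergy, ← hL]
    _ ≤ D * C * ‖z‖ₑ ^ 2 := by
        gcongr
        exact hde.frameEnergy_le z

theorem IsInnerMul.isBesselSeq_bilinSumSeq [CompleteSpace E] [CompleteSpace F] [CompleteSpace K]
    (hB : IsInnerMul B) {f₁ : Fin r → ι₁ → E} {f₂ : Fin r → ι₂ → F}
    (h₁ : ∀ k, IsBesselSeq 𝕜 (f₁ k)) (h₂ : ∀ k, IsBesselSeq 𝕜 (f₂ k)) :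
    IsBesselSeq 𝕜 (bilinSumSeq B f₁ f₂) := by
  have h : bilinSumSeq B f₁ f₂ = ∑ k, fun p : ι₁ × ι₂ => B (f₁ k p.1) (f₂ k p.2) := by
    funext p
    simp [bilinSumSeq]
  rw [← mem_besselSubmodule, h]
  refine Submodule.sum_mem _ fun k _ => ?_
  obtain ⟨C, hC⟩ := isBesselSeq_iff_frameEnergy.1 (h₁ k)
  obtain ⟨D, hD⟩ := isBesselSeq_iff_frameEnergy.1 (h₂ k)
  exact isBesselSeq_iff_frameEnergy.2 ⟨D * C, fun z => by
    simpa using hB.frameEnergy_tmul_le hC hD z⟩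

theorem IsInnerMul.isBesselSeq_right (hB : IsInnerMul B) {f₁ : Fin r → ι₁ → E}
    {f₂ : Fin r → ι₂ → F} (hf₁ : LinearIndependent 𝕜 f₁)
    (h : IsBesselSeq 𝕜 (bilinSumSeq B f₁ f₂)) (k : Fin r) : IsBesselSeq 𝕜 (f₂ k) :=
  hB.flip.isBesselSeq_left hf₁ (bilinSumSeq_flip B f₁ f₂ ▸ h.comp_equiv _) k

theorem LinearIndependent.exists_apply_ne_zero (hr : 1 ≤ r) {f : Fin r → ι₂ → F}
    (hf : LinearIndependent 𝕜 f) : ∃ k n, f k n ≠ 0 :=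
  ⟨⟨0, hr⟩, Function.ne_iff.1 (hf.ne_zero ⟨0, hr⟩)⟩

/-- Cauchy–Schwarz over the `r` terms costs the factor `r`; each remaining double sum factors. -/
theorem IsInnerMul.frameEnergy_bilinSumSeq_le (hB : IsInnerMul B) (f₁ : Fin r → ι₁ → E)
    (f₂ : Fin r → ι₂ → F) (x : E) (y : F) :
    frameEnergy 𝕜 (bilinSumSeq B f₁ f₂) (B x y) ≤
      r * ∑ k, frameEnergy 𝕜 (f₁ k) x * frameEnergy 𝕜 (f₂ k) y := by
  calc frameEnergy 𝕜 (bilinSumSeq B f₁ f₂) (B x y)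
      ≤ ∑' p : ι₁ × ι₂, r * ∑ k, ‖⟪f₁ k p.1, x⟫_𝕜‖ₑ ^ 2 * ‖⟪f₂ k p.2, y⟫_𝕜‖ₑ ^ 2 := by
        refine ENNReal.tsum_le_tsum fun p => ?_
        rw [hB.inner_bilinSumSeq]
        simpa [enorm_mul, mul_pow] using
          enorm_sum_sq_le Finset.univ fun k => ⟪f₁ k p.1, x⟫_𝕜 * ⟪f₂ k p.2, y⟫_𝕜
    _ = _ := by
        rw [ENNReal.tsum_mul_left, Summable.tsum_finsetSum fun _ _ => ENNReal.summable]
        congr 1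
        refine Finset.sum_congr rfl fun k _ => ?_
        rw [ENNReal.tsum_prod']
        simp_rw [ENNReal.tsum_mul_left, ENNReal.tsum_mul_right]
        rfl

/-- The concatenation of the first factors of a frame of sums of tensors is a frame. -/
theorem IsInnerMul.isFrameSeq_concatSeq_left (hB : IsInnerMul B) (hr : 1 ≤ r)
    {f₁ : Fin r → ι₁ → E} {f₂ : Fin r → ι₂ → F} (hf₁ : LinearIndependent 𝕜 f₁)
    (hf₂ : LinearIndependent 𝕜 f₂) (h : IsFrameSeq 𝕜 (bilinSumSeq B f₁ f₂)) :
    IsFrameSeq 𝕜 (concatSeq f₁) := by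
  obtain ⟨hbes, A, hA, hlow⟩ := isFrameSeq_iff_frameEnergy.1 h
  choose C hC using fun k => isBesselSeq_iff_frameEnergy.1 (hB.isBesselSeq_left hf₂ hbes k)
  choose D hD using fun k => isBesselSeq_iff_frameEnergy.1 (hB.isBesselSeq_right hf₁ hbes k)
  -- Any nonzero `y` would do, since `‖y‖²` cancels from `key`.
  obtain ⟨k₀, n₀, hy⟩ := hf₂.exists_apply_ne_zero hr
  set y := f₂ k₀ n₀
  refine isFrameSeq_iff_frameEnergy.2 ⟨isBesselSeq_iff_frameEnergy.2 ⟨∑ k, C k, fun x => ?_⟩, ?_⟩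
  · rw [frameEnergy_concatSeq]
    push_cast
    rw [Finset.sum_mul]
    exact Finset.sum_le_sum fun k _ => hC k x
  -- The `+ 1` makes `M` nonzero, so that dividing by it is legitimate.
  set M : ℝ≥0 := r * ∑ k, D k + 1
  refine ⟨A / M, by positivity, fun x => ?_⟩
  have hy0 : ‖y‖ₑ ^ 2 ≠ 0 := by simpa using hy
  have hyt : ‖y‖ₑ ^ 2 ≠ ∞ := by simp
  have key : A * ‖x‖ₑ ^ 2 * ‖y‖ₑ ^ 2 ≤ M * frameEnergy 𝕜 (concatSeq f₁) x * ‖y‖ₑ ^ 2 :=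
    calc A * ‖x‖ₑ ^ 2 * ‖y‖ₑ ^ 2 = A * ‖B x y‖ₑ ^ 2 := by
          rw [hB.enorm_apply, mul_pow, mul_assoc]
      _ ≤ r * ∑ k, frameEnergy 𝕜 (f₁ k) x * frameEnergy 𝕜 (f₂ k) y :=
          (hlow _).trans (hB.frameEnergy_bilinSumSeq_le f₁ f₂ x y)
      _ ≤ r * ∑ k, frameEnergy 𝕜 (f₁ k) x * (((∑ k, D k : ℝ≥0) : ℝ≥0∞) * ‖y‖ₑ ^ 2) := by
          gcongr with k
          refine (hD k y).trans ?_
          gcongr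
          exact Finset.single_le_sum (fun _ _ => zero_le) (Finset.mem_univ k)
      _ = ((r * ∑ k, D k : ℝ≥0) : ℝ≥0∞) * frameEnergy 𝕜 (concatSeq f₁) x * ‖y‖ₑ ^ 2 := by
          rw [← Finset.sum_mul, frameEnergy_concatSeq, ENNReal.coe_mul, ENNReal.coe_natCast]
          ring
      _ ≤ _ := by
          gcongr
          exact le_self_add
  rw [ENNReal.mul_le_mul_iff_left hy0 hyt] at key
  have hM : M ≠ 0 := by positivity
  rw [ENNReal.coe_div hM, ENNReal.mul_div_right_comm.symm]
  exact ENNReal.div_le_of_le_mul' key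

/-- If bounded operators `J k` turn the sequences `f k` into an orthonormal sequence
`m ↦ ∑ k, J k (f k m)`, then the operators associated to the `f k` are jointly right invertible. -/
theorem exists_sum_comp_eq_id_of_orthonormal [CompleteSpace E] {f : Fin r → ι₁ → E}
    {e : HilbertBasis ι₁ 𝕜 E} {G : Fin r → E →L[𝕜] E} (hG : ∀ k, IsAssociatedOp e (f k) (G k))
    (J : Fin r → E →L[𝕜] K) (h : Orthonormal 𝕜 fun m => ∑ k, J k (f k m)) :
    ∃ R : Fin r → E →L[𝕜] E, ∑ k, G k ∘L R k = ContinuousLinearMap.id 𝕜 E := by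
  set V : E →L[𝕜] K := ∑ k, J k ∘L (G k).adjoint with hV
  have hVe (m : ι₁) : V (e m) = ∑ k, J k (f k m) := by
    simp [hV, (hG _).adjoint_basis]
  have hiso (x : E) (m : ι₁) : ⟪V (e m), V x⟫_𝕜 = ⟪e m, x⟫_𝕜 := by
    have h1 := (innerSL 𝕜 (V (e m))).hasSum (V.hasSum (e.hasSum_repr x))
    refine h1.unique ?_
    classical
    convert hasSum_ite_eq m ⟪e m, x⟫_𝕜 using 2 with j
    simp only [innerSL_apply_apply, map_smul, e.repr_apply_apply,
      hVe, orthonormal_iff_ite.1 h]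
    by_cases hj : j = m
    · simp [hj]
    · simp [hj, Ne.symm hj]
  -- By `hiso`, the coefficients of `x` along `e` are those of `V x` along the orthonormal vectors
  -- `V (e m)`; Bessel's inequality in `K` concludes.
  have hle (x : E) : ‖x‖ₑ ^ 2 ≤ ‖V x‖ₑ ^ 2 := by
    rw [← e.frameEnergy_eq]
    simp_rw [frameEnergy, ← hiso x, hVe]
    exact h.frameEnergy_le (V x)
  set M : ℝ≥0 := r * ∑ k, ‖J k‖₊ ^ 2 + 1
  refine exists_sum_comp_eq_id_of_adjoint_le G (A := M⁻¹) (by positivity) fun x => ?_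
  have hM : M ≠ 0 := by positivity
  rw [ENNReal.coe_inv hM, mul_comm, ← div_eq_mul_inv]
  refine ENNReal.div_le_of_le_mul' ?_
  calc ‖x‖ₑ ^ 2 ≤ ‖∑ k, J k ((G k).adjoint x)‖ₑ ^ 2 := by simpa [hV] using hle x
    _ ≤ r * ∑ k, ‖J k ((G k).adjoint x)‖ₑ ^ 2 := by
        simpa using enorm_sum_sq_le Finset.univ fun k => J k ((G k).adjoint x)
    _ ≤ r * ∑ k, ((∑ k, ‖J k‖₊ ^ 2 : ℝ≥0) : ℝ≥0∞) * ‖(G k).adjoint x‖ₑ ^ 2 := by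
        gcongr with k
        refine (pow_le_pow_left' ((J k).le_opENorm _) 2).trans ?_
        rw [mul_pow, enorm_eq_nnnorm (J k), ← ENNReal.coe_pow]
        gcongr
        exact Finset.single_le_sum (f := fun k => ‖J k‖₊ ^ 2) (fun _ _ => zero_le)
          (Finset.mem_univ k)
    _ = ((r * ∑ k, ‖J k‖₊ ^ 2 : ℝ≥0) : ℝ≥0∞) * ∑ k, ‖(G k).adjoint x‖ₑ ^ 2 := by
        rw [← Finset.mul_sum, ENNReal.coe_mul, ENNReal.coe_natCast, mul_assoc]
    _ ≤ _ := by
        gcongr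
        exact le_self_add

/-- For a Riesz basis of sums of tensors, the operators associated to the first factors are
jointly right invertible. -/
theorem IsRieszBasisSeq.exists_sum_comp_eq_id_left [CompleteSpace E] {f₁ : Fin r → ι₁ → E}
    {f₂ : Fin r → ι₂ → F} (h : IsRieszBasisSeq 𝕜 (bilinSumSeq B f₁ f₂)) (n : ι₂)
    {e : HilbertBasis ι₁ 𝕜 E} {G : Fin r → E →L[𝕜] E}
    (hG : ∀ k, IsAssociatedOp e (f₁ k) (G k)) :
    ∃ R : Fin r → E →L[𝕜] E, ∑ k, G k ∘L R k = ContinuousLinearMap.id 𝕜 E := by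
  obtain ⟨-, b, T, hT⟩ := h
  refine exists_sum_comp_eq_id_of_orthonormal hG
    (fun k => (T.symm : K →L[𝕜] K) ∘L B.flip (f₂ k n)) ?_
  -- Undoing `T` turns the slice with `n` fixed into part of the orthonormal basis `b`.
  have hb (m : ι₁) : ∑ k, ((T.symm : K →L[𝕜] K) ∘L B.flip (f₂ k n)) (f₁ k m) = b (m, n) := by
    rw [← T.symm_apply_apply (b (m, n)), ← hT]
    simp [bilinSumSeq]
  simp_rw [hb]
  exact b.orthonormal.comp _ fun _ _ h => (Prod.ext_iff.1 h).1

theorem IsRieszBasisSeq.exists_sum_comp_eq_id_right [CompleteSpace F] {f₁ : Fin r → ι₁ → E}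
    {f₂ : Fin r → ι₂ → F} (h : IsRieszBasisSeq 𝕜 (bilinSumSeq B f₁ f₂)) (m : ι₁)
    {e : HilbertBasis ι₂ 𝕜 F} {G : Fin r → F →L[𝕜] F}
    (hG : ∀ k, IsAssociatedOp e (f₂ k) (G k)) :
    ∃ R : Fin r → F →L[𝕜] F, ∑ k, G k ∘L R k = ContinuousLinearMap.id 𝕜 F := by
  obtain ⟨-, b, T, hT⟩ := h
  refine exists_sum_comp_eq_id_of_orthonormal hG
    (fun k => (T.symm : K →L[𝕜] K) ∘L B (f₁ k m)) ?_
  have hb (n : ι₂) : ∑ k, ((T.symm : K →L[𝕜] K) ∘L B (f₁ k m)) (f₂ k n) = b (m, n) := by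
    rw [← T.symm_apply_apply (b (m, n)), ← hT]
    simp [bilinSumSeq]
  simp_rw [hb]
  exact b.orthonormal.comp _ fun _ _ h => (Prod.ext_iff.1 h).2

theorem IsInnerMul.isFrameSeq_concatSeq_right (hB : IsInnerMul B) (hr : 1 ≤ r)
    {f₁ : Fin r → ι₁ → E} {f₂ : Fin r → ι₂ → F} (hf₁ : LinearIndependent 𝕜 f₁)
    (hf₂ : LinearIndependent 𝕜 f₂) (h : IsFrameSeq 𝕜 (bilinSumSeq B f₁ f₂)) :
    IsFrameSeq 𝕜 (concatSeq f₂) :=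
  hB.flip.isFrameSeq_concatSeq_left hr hf₂ hf₁ (bilinSumSeq_flip B f₁ f₂ ▸ h.comp_equiv _)

end TensorLike

/-! ### The Hilbert space tensor product and the theorem -/

/-- The elementary tensor as a bounded bilinear map. -/
noncomputable def hilbertTmulL (𝕜 : Type*) [RCLike 𝕜] (E F : Type*)
    [NormedAddCommGroup E] [InnerProductSpace 𝕜 E]
    [NormedAddCommGroup F] [InnerProductSpace 𝕜 F] : E →L[𝕜] F →L[𝕜] HilbertTensor 𝕜 E F :=
  (ContinuousLinearMap.compL 𝕜 F (E ⊗[𝕜] F) (HilbertTensor 𝕜 E F)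
    UniformSpace.Completion.toComplL) ∘L TensorProduct.mkL 𝕜 E F

theorem isInnerMul_hilbertTmulL (𝕜 : Type*) [RCLike 𝕜] (E F : Type*)
    [NormedAddCommGroup E] [InnerProductSpace 𝕜 E]
    [NormedAddCommGroup F] [InnerProductSpace 𝕜 F] : IsInnerMul (hilbertTmulL 𝕜 E F) :=
  fun _ _ _ _ => (UniformSpace.Completion.inner_coe _ _).trans (TensorProduct.inner_tmul ..)

theorem sumTensorSeq_eq_bilinSumSeq (𝕜 : Type*) [RCLike 𝕜] {E F : Type*}
    [NormedAddCommGroup E] [InnerProductSpace 𝕜 E]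
    [NormedAddCommGroup F] [InnerProductSpace 𝕜 F] {ι₁ ι₂ : Type*} {r : ℕ}
    (f₁ : Fin r → ι₁ → E) (f₂ : Fin r → ι₂ → F) :
    sumTensorSeq 𝕜 f₁ f₂ = bilinSumSeq (hilbertTmulL 𝕜 E F) f₁ f₂ := rfl


theorem theorem3p2 {𝕜 : Type*} [RCLike 𝕜]
    {H₁ : Type*} [NormedAddCommGroup H₁] [InnerProductSpace 𝕜 H₁] [CompleteSpace H₁]
    [TopologicalSpace.SeparableSpace H₁]
    {H₂ : Type*} [NormedAddCommGroup H₂] [InnerProductSpace 𝕜 H₂] [CompleteSpace H₂]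
    [TopologicalSpace.SeparableSpace H₂]
    {ι₁ ι₂ : Type*} [Countable ι₁] [Countable ι₂]
    (r : ℕ) (hr : 1 ≤ r)
    (f₁ : Fin r → ι₁ → H₁) (f₂ : Fin r → ι₂ → H₂)
    (hf₁ : LinearIndependent 𝕜 f₁) (hf₂ : LinearIndependent 𝕜 f₂) :
    -- (i)
    (IsBesselSeq 𝕜 (sumTensorSeq 𝕜 f₁ f₂) ↔
      (∀ k, IsBesselSeq 𝕜 (f₁ k)) ∧ (∀ k, IsBesselSeq 𝕜 (f₂ k))) ∧
    -- (ii)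
    (IsFrameSeq 𝕜 (sumTensorSeq 𝕜 f₁ f₂) →
      (∀ (e₁ : HilbertBasis ι₁ 𝕜 H₁) (e₂ : HilbertBasis ι₂ 𝕜 H₂),
        ∃ (F₁ L₁ : Fin r → H₁ →L[𝕜] H₁) (F₂ L₂ : Fin r → H₂ →L[𝕜] H₂),
          (∀ k, IsAssociatedOp e₁ (f₁ k) (F₁ k)) ∧ (∀ k, IsAssociatedOp e₂ (f₂ k) (F₂ k)) ∧
          ∑ k, L₁ k ∘L F₁ k = ContinuousLinearMap.id 𝕜 H₁ ∧
          ∑ k, L₂ k ∘L F₂ k = ContinuousLinearMap.id 𝕜 H₂) ∧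
      IsFrameSeq 𝕜 (concatSeq f₁) ∧ IsFrameSeq 𝕜 (concatSeq f₂)) ∧
    -- (iii)
    (IsRieszBasisSeq 𝕜 (sumTensorSeq 𝕜 f₁ f₂) →
      (∀ (e₁ : HilbertBasis ι₁ 𝕜 H₁) (e₂ : HilbertBasis ι₂ 𝕜 H₂),
        ∃ (F₁ L₁ R₁ : Fin r → H₁ →L[𝕜] H₁) (F₂ L₂ R₂ : Fin r → H₂ →L[𝕜] H₂),
          (∀ k, IsAssociatedOp e₁ (f₁ k) (F₁ k)) ∧ (∀ k, IsAssociatedOp e₂ (f₂ k) (F₂ k)) ∧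
          ∑ k, L₁ k ∘L F₁ k = ContinuousLinearMap.id 𝕜 H₁ ∧
          ∑ k, L₂ k ∘L F₂ k = ContinuousLinearMap.id 𝕜 H₂ ∧
          ∑ k, F₁ k ∘L R₁ k = ContinuousLinearMap.id 𝕜 H₁ ∧
          ∑ k, F₂ k ∘L R₂ k = ContinuousLinearMap.id 𝕜 H₂) ∧
      IsFrameSeq 𝕜 (concatSeq f₁) ∧ IsFrameSeq 𝕜 (concatSeq f₂)) := by

  have hB := isInnerMul_hilbertTmulL 𝕜 H₁ H₂
  rw [sumTensorSeq_eq_bilinSumSeq]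
  have hleft (hF : IsFrameSeq 𝕜 (bilinSumSeq (hilbertTmulL 𝕜 H₁ H₂) f₁ f₂))
      (e₁ : HilbertBasis ι₁ 𝕜 H₁) (e₂ : HilbertBasis ι₂ 𝕜 H₂) :
      ∃ (F₁ L₁ : Fin r → H₁ →L[𝕜] H₁) (F₂ L₂ : Fin r → H₂ →L[𝕜] H₂),
        (∀ k, IsAssociatedOp e₁ (f₁ k) (F₁ k)) ∧ (∀ k, IsAssociatedOp e₂ (f₂ k) (F₂ k)) ∧
        ∑ k, L₁ k ∘L F₁ k = ContinuousLinearMap.id 𝕜 H₁ ∧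
        ∑ k, L₂ k ∘L F₂ k = ContinuousLinearMap.id 𝕜 H₂ := by
    have hb := (isFrameSeq_iff_frameEnergy.1 hF).1
    choose F₁ hF₁ using fun k => (hB.isBesselSeq_left hf₂ hb k).exists_isAssociatedOp e₁
    choose F₂ hF₂ using fun k => (hB.isBesselSeq_right hf₁ hb k).exists_isAssociatedOp e₂
    obtain ⟨L₁, hL₁⟩ := (hB.isFrameSeq_concatSeq_left hr hf₁ hf₂ hF).exists_sum_comp_eq_id hF₁
    obtain ⟨L₂, hL₂⟩ := (hB.isFrameSeq_concatSeq_right hr hf₁ hf₂ hF).exists_sum_comp_eq_id hF₂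
    exact ⟨F₁, L₁, F₂, L₂, hF₁, hF₂, hL₁, hL₂⟩
  refine ⟨⟨fun h => ⟨hB.isBesselSeq_left hf₂ h, hB.isBesselSeq_right hf₁ h⟩,
    fun h => hB.isBesselSeq_bilinSumSeq h.1 h.2⟩,
    fun h => ⟨hleft h, hB.isFrameSeq_concatSeq_left hr hf₁ hf₂ h,
      hB.isFrameSeq_concatSeq_right hr hf₁ hf₂ h⟩,
    fun h => ⟨fun e₁ e₂ => ?_, hB.isFrameSeq_concatSeq_left hr hf₁ hf₂ h.1,
      hB.isFrameSeq_concatSeq_right hr hf₁ hf₂ h.1⟩⟩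
  obtain ⟨F₁, L₁, F₂, L₂, hF₁, hF₂, hL₁, hL₂⟩ := hleft h.1 e₁ e₂
  -- Slicing needs an index in each factor; independence with `1 ≤ r` provides one.
  obtain ⟨-, m, -⟩ := hf₁.exists_apply_ne_zero hr
  obtain ⟨-, n, -⟩ := hf₂.exists_apply_ne_zero hr
  obtain ⟨R₁, hR₁⟩ := h.exists_sum_comp_eq_id_left n hF₁
  obtain ⟨R₂, hR₂⟩ := h.exists_sum_comp_eq_id_right m hF₂
  exact ⟨F₁, L₁, R₁, F₂, L₂, R₂, hF₁, hF₂, hL₁, hL₂, hR₁, hR₂⟩
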